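/- **Conventions.** Circuits are Boolean circuits with unbounded fan-out over AND and OR gates of fan-in two and NOT gates; the size of a circuit is its number of gates (input bits and constants are free). Let $\mathcal{X}$ be a finite set whose elements are presented to circuits through an injective encoding $\mathcal{X}\to\{0,1\}^n$; a $k$-tuple in $\mathcal{X}^k$ is presented as the $kn$ bits of the encodings of its entries. Random variables over $\mathcal{X}$ are identified with their distributions, $X^{\otimes k}$ is the distribution of $k$ independent samples from $X$, and $d_{TV}(X,Y)=\frac12\sum_x|\Pr[X=x]-\Pr[Y=x]|$. For real $\delta$ and $t$, random variables $X,Y$ are *$\delta$-indistinguishable by circuits of size $t$* if $\left|\sum_x f(x)(\Pr[X=x]-\Pr[Y=x])\right|\le\delta$ for every $f$ with values in $\{0,1\}$ that is computable by a circuit of size at most $t$; they are *$\delta$-distinguishable by circuits of size $t$* if $\left|\sum_x f(x)(\Pr[X=x]-\Pr[Y=x])\right|\ge\delta$ for some such $f$. **Theorem 1.1.** There are universal constants $C\in\mathbb{R}$ and $c\in\mathbb{N}$ such that for every finite set $\mathcal{X}$ with an injective encoding into $\{0,1\}^n$ for some $n\in\mathbb{N}$, every pair of random variables $X_0,X_1$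 over $\mathcal{X}$, every integer $s\ge 0$ and every real $\varepsilon>0$, both of the following hold. (A) There exist random variables $\widetilde X_0,\widetilde X_1$ over $\mathcal{X}$ such that for every integer $k>0$: 1. $X_b$ is $\varepsilon$-indistinguishable from $\widetilde X_b$ by circuits of size $s$, for each $b\in\{0,1\}$. 2. $X_0^{\otimes k}$ and $X_1^{\otimes k}$ are $\left(d_{TV}(\widetilde X_0^{\otimes k},\widetilde X_1^{\otimes k})+2k\varepsilon\right)$-indistinguishable by circuits of size $s$. 3. $X_0^{\otimes k}$ and $X_1^{\otimes k}$ are $\left(d_{TV}(\widetilde X_0^{\otimes k},\widetilde X_1^{\otimes k})-2k\varepsilon\right)$-distinguishable by circuits of size $C\,sk/\varepsilon^{6}+C\,(k/\varepsilon)^{c}$. (B) There exists a random variable $\widetilde X_0$ over $\mathcal{X}$ such that for every integer $k>0$: 1. $X_0$ is $\varepsilon$-indistinguishable from $\widetilde X_0$ by circuits of size $s$. 2. $X_0^{\otimes k}$ and $X_1^{\otimes k}$ are $\left(d_{TV}(\widetilde X_0^{\otimes k},X_1^{\otimes k})+2k\varepsilon\right)$-indistinguishable by circuits of size $s$. 3.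 $X_0^{\otimes k}$ and $X_1^{\otimes k}$ are $\left(d_{TV}(\widetilde X_0^{\otimes k},X_1^{\otimes k})-2k\varepsilon\right)$-distinguishable by circuits of size $C\,sk/\varepsilon^{12}+C\,(k/\varepsilon)^{c}$. -/

import Mathlib

namespace SampleDistinguishing

/-- What a gate may read, when `m` gates have been computed before it: a constant, an input bit,
or the value of one of the earlier gates. -/
inductive Source (ι : Type*) (m : ℕ) : Type _
  | const (b : Bool) : Source ι m
  | input (i : ι) : Source ι m
  | gate (j : Fin m) : Source ι m

/-- The value of a source on the input `x`, given the values `v` of the earlier gates. -/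
def Source.eval {ι : Type*} {m : ℕ} (x : ι → Bool) (v : Fin m → Bool) : Source ι m → Bool
  | .const b => b
  | .input i => x i
  | .gate j => v j

/-- A NOT gate, or an AND or OR gate of fan-in two. -/
inductive Gate (ι : Type*) (m : ℕ) : Type _
  | not (a : Source ι m) : Gate ι m
  | and (a b : Source ι m) : Gate ι m
  | or (a b : Source ι m) : Gate ι m

/-- The value of a gate on the input `x`, given the values `v` of the earlier gates. -/
def Gate.eval {ι : Type*} {m : ℕ} (x : ι → Bool) (v : Fin m → Bool) : Gate ι m → Bool
  | .not a => !(a.eval x v)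
  | .and a b => a.eval x v && b.eval x v
  | .or a b => a.eval x v || b.eval x v

/-- A topologically ordered list of `m` gates (fan-out is unbounded). -/
inductive Gates (ι : Type*) : ℕ → Type _
  | nil : Gates ι 0
  | snoc {m : ℕ} (P : Gates ι m) (g : Gate ι m) : Gates ι (m + 1)

/-- The values of all the gates on the input `x`. -/
def Gates.eval {ι : Type*} (x : ι → Bool) : {m : ℕ} → Gates ι m → Fin m → Bool
  | _, .nil => Fin.elim0
  | _, .snoc P g => Fin.snoc (α := fun _ => Bool) (P.eval x) (g.eval x (P.eval x))

/-- A Boolean circuit with one output on input bits indexed by `ι`. Its size is the number of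
gates; input bits and constants are not counted. -/
structure Circuit (ι : Type*) where
  size : ℕ
  gates : Gates ι size
  output : Source ι size

/-- The output of a circuit on the input `x`. -/
def Circuit.eval {ι : Type*} (C : Circuit ι) (x : ι → Bool) : Bool :=
  C.output.eval x (C.gates.eval x)

/-- `f` is computable by a circuit of size at most `s`, when the elements of the domain are
presented to circuits through the binary encoding `enc`. -/
def ComputableBySize {𝒳 ι : Type*} (enc : 𝒳 → ι → Bool) (s : ℝ) (f : 𝒳 → Bool) : Prop :=
  ∃ C : Circuit ι, (C.size : ℝ) ≤ s ∧ ∀ x, C.eval (enc x) = f x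

/-- The advantage of the test `f` in telling `X` from `Y`. -/
noncomputable def advantage {𝒳 : Type*} [Fintype 𝒳] (f : 𝒳 → Bool) (X Y : PMF 𝒳) : ℝ :=
  |∑ x, (if f x then 1 else 0) * ((X x).toReal - (Y x).toReal)|

/-- `X` and `Y` are `δ`-indistinguishable by circuits of size `s`. -/
def Indistinguishable {𝒳 ι : Type*} [Fintype 𝒳] (enc : 𝒳 → ι → Bool) (s δ : ℝ)
    (X Y : PMF 𝒳) : Prop :=
  ∀ f : 𝒳 → Bool, ComputableBySize enc s f → advantage f X Y ≤ δ

/-- `X` and `Y` are `δ`-distinguishable by circuits of size `s`. -/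
def Distinguishable {𝒳 ι : Type*} [Fintype 𝒳] (enc : 𝒳 → ι → Bool) (s δ : ℝ)
    (X Y : PMF 𝒳) : Prop :=
  ∃ f : 𝒳 → Bool, ComputableBySize enc s f ∧ δ ≤ advantage f X Y

/-- Total variation distance. -/
noncomputable def dTV {𝒳 : Type*} [Fintype 𝒳] (X Y : PMF 𝒳) : ℝ :=
  1 / 2 * ∑ x, |(X x).toReal - (Y x).toReal|

/-- The distribution of `k` independent samples from `X`. -/
noncomputable def iid {𝒳 : Type*} [Fintype 𝒳] (X : PMF 𝒳) (k : ℕ) : PMF (Fin k → 𝒳) :=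
  PMF.ofFintype (fun x => ∏ i, X (x i)) (by
    classical
    have h : ∑ a, X a = 1 := by rw [← tsum_fintype (L := .unconditional _)]; exact X.tsum_coe
    rw [← Fintype.piFinset_univ, ← Finset.prod_univ_sum]
    simp [h])

/-- The encoding of a `k`-tuple of samples: the encodings of its entries, side by side. -/
def encTuple {𝒳 ι : Type*} (enc : 𝒳 → ι → Bool) (k : ℕ) (x : Fin k → 𝒳) : Fin k × ι → Bool :=
  fun p => enc (x p.1) p.2

end SampleDistinguishing

open SampleDistinguishing

/-!
Both parts follow from one construction, which replaces `X₀` by a simulation `Y` and keeps `X₁`; in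
the first part `X₁` itself serves as the second distribution.

*Partition.* A predictor assigns to each `x` one of the levels `0, 1 / M, …, 1`, as an estimate of
the probability that `x` was drawn from `X₀` rather than from `X₁`. As long as some test of size
`s`, with a sign for each level, correlates with the error of the prediction by more than `2 / M`,
moving one level up or down along this test lowers the squared error by `2 / M ^ 2`. Hence after
`O(M ^ 2)` moves no test does (`exists_steps_sum_abs_cellSum_le`). The predictor is then a
branching program of that length with `M + 1` states, whose instructions evaluate tests of size
`s`.

*Simulation.* In the cells of the partition where the mass of `X₁` is at least `κ` times that of
`X₀`, `Y` is proportional to `X₁` within the cell and gives the cell the same mass as `X₀`; in the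
other cells it agrees with `X₀`. As the tests detect hardly any bias within the cells, they tell
`Y` from `X₀` with advantage `O(1 / (κ * M))` at most (`abs_cellSum_sub_cellSum_simulated_le`).
The likelihood ratio of `Y` and `X₁` is constant on the former cells, and the latter carry mass at
most `κ` of `X₁`. With `κ` of the order `ε` and `M` of the order `ε⁻²` this gives about `ε⁻⁴`
tests for each sample.

*Distinguisher.* The likelihood ratios can be rounded to powers of `ρ = 1 + 1 / N`, with exponents
`w` of size at most `N ^ 2` (`exists_zpow_odds_close`). The test for `∑ w ≥ 0` is then optimal up
to the error of rounding (`dTV_iid_sub_le_weight_test`); as it depends on the cells alone, it has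
the same acceptance probability for `X₀` as for `Y`. The partial sums of `w` take few values, so
the whole test is a branching program of polynomial width, which a circuit evaluates backwards
with a few gates for each state (`jointlyComputable_weightSum`).
-/

namespace SampleDistinguishing

/-! ### Simultaneous computation of several Boolean functions -/

/-- One of the sources available to a gate that follows `P` carries the function `φ`. -/
def Gates.Computes {ι : Type*} {m : ℕ} (P : Gates ι m) (φ : (ι → Bool) → Bool) : Prop :=
  ∃ a : Source ι m, ∀ x, a.eval x (P.eval x) = φ x

/-- All functions in `Φ` can be read off a single list of at most `t` gates. -/
def JointlyComputable {ι : Type*} (t : ℕ) (Φ : Set ((ι → Bool) → Bool)) : Prop :=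
  ∃ m ≤ t, ∃ P : Gates ι m, ∀ φ ∈ Φ, P.Computes φ

variable {ι κ : Type*}

theorem Gates.Computes.snoc {m : ℕ} {P : Gates ι m} {φ : (ι → Bool) → Bool}
    (h : P.Computes φ) (g : Gate ι m) : (P.snoc g).Computes φ := by
  obtain ⟨a, ha⟩ := h
  cases a with
  | const b => exact ⟨.const b, ha⟩
  | input i => exact ⟨.input i, ha⟩
  | gate j => exact ⟨.gate j.castSucc, fun x => by simpa [Source.eval, Gates.eval] using ha x⟩

theorem Gates.computes_snoc {m : ℕ} (P : Gates ι m) (g : Gate ι m) :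
    (P.snoc g).Computes (fun x => g.eval x (P.eval x)) :=
  ⟨.gate (Fin.last m), fun x => by simp [Source.eval, Gates.eval]⟩

theorem Gates.computes_source {m : ℕ} (P : Gates ι m) (a : Source ι 0) :
    P.Computes (fun x => a.eval x Fin.elim0) := by
  cases a with
  | const b => exact ⟨.const b, fun _ => rfl⟩
  | input i => exact ⟨.input i, fun _ => rfl⟩
  | gate j => exact j.elim0

theorem JointlyComputable.mono {t t' : ℕ} {Φ Φ' : Set ((ι → Bool) → Bool)}
    (h : JointlyComputable t Φ) (ht : t ≤ t') (hΦ : Φ' ⊆ Φ) : JointlyComputable t' Φ' := by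
  obtain ⟨m, hm, P, hP⟩ := h
  exact ⟨m, hm.trans ht, P, fun φ hφ => hP φ (hΦ hφ)⟩

theorem jointlyComputable_empty : JointlyComputable 0 (∅ : Set ((ι → Bool) → Bool)) :=
  ⟨0, le_rfl, .nil, by simp⟩

theorem jointlyComputable_const :
    JointlyComputable 0 (Set.range fun (b : Bool) (_ : ι → Bool) => b) :=
  ⟨0, le_rfl, .nil, by rintro _ ⟨b, rfl⟩; exact ⟨.const b, fun _ => rfl⟩⟩

theorem JointlyComputable.insert_not {t : ℕ} {Φ : Set ((ι → Bool) → Bool)}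
    (h : JointlyComputable t Φ) {φ : (ι → Bool) → Bool} (hφ : φ ∈ Φ) :
    JointlyComputable (t + 1) (insert (fun x => !φ x) Φ) := by
  obtain ⟨m, hm, P, hP⟩ := h
  obtain ⟨a, ha⟩ := hP φ hφ
  refine ⟨m + 1, by omega, P.snoc (.not a), ?_⟩
  rintro ψ (rfl | hψ)
  · simpa [Gate.eval, ha] using P.computes_snoc (.not a)
  · exact (hP ψ hψ).snoc _

theorem JointlyComputable.insert_and {t : ℕ} {Φ : Set ((ι → Bool) → Bool)}
    (h : JointlyComputable t Φ) {φ χ : (ι → Bool) → Bool} (hφ : φ ∈ Φ) (hχ : χ ∈ Φ) :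
    JointlyComputable (t + 1) (insert (fun x => φ x && χ x) Φ) := by
  obtain ⟨m, hm, P, hP⟩ := h
  obtain ⟨a, ha⟩ := hP φ hφ
  obtain ⟨b, hb⟩ := hP χ hχ
  refine ⟨m + 1, by omega, P.snoc (.and a b), ?_⟩
  rintro ψ (rfl | hψ)
  · simpa [Gate.eval, ha, hb] using P.computes_snoc (.and a b)
  · exact (hP ψ hψ).snoc _

theorem JointlyComputable.insert_or {t : ℕ} {Φ : Set ((ι → Bool) → Bool)}
    (h : JointlyComputable t Φ) {φ χ : (ι → Bool) → Bool} (hφ : φ ∈ Φ) (hχ : χ ∈ Φ) :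
    JointlyComputable (t + 1) (insert (fun x => φ x || χ x) Φ) := by
  obtain ⟨m, hm, P, hP⟩ := h
  obtain ⟨a, ha⟩ := hP φ hφ
  obtain ⟨b, hb⟩ := hP χ hχ
  refine ⟨m + 1, by omega, P.snoc (.or a b), ?_⟩
  rintro ψ (rfl | hψ)
  · simpa [Gate.eval, ha, hb] using P.computes_snoc (.or a b)
  · exact (hP ψ hψ).snoc _

/-- The values presented to the inputs `κ` when each of them is wired to an input bit in `ι` or to
a constant: a `Source ι 0` can be nothing else. -/
def wire (σ : κ → Source ι 0) (x : ι → Bool) : κ → Bool :=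
  fun i => (σ i).eval x Fin.elim0

theorem Source.exists_wire {m q : ℕ} {P : Gates ι m} {Q : Gates κ q} (σ : κ → Source ι 0)
    (hP : ∀ j, P.Computes fun x => Q.eval (wire σ x) j) (a : Source κ q) :
    ∃ a' : Source ι m, ∀ x, a'.eval x (P.eval x) = a.eval (wire σ x) (Q.eval (wire σ x)) := by
  cases a with
  | const b => exact ⟨.const b, fun _ => rfl⟩
  | input i => exact P.computes_source (σ i)
  | gate j => exact hP j

theorem Gates.exists_wire {m q : ℕ} (P : Gates ι m) (Q : Gates κ q) (σ : κ → Source ι 0) :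
    ∃ P' : Gates ι (m + q), (∀ φ, P.Computes φ → P'.Computes φ) ∧
      ∀ j, P'.Computes fun x => Q.eval (wire σ x) j := by
  induction Q with
  | nil => exact ⟨P, fun _ h => h, fun j => j.elim0⟩
  | @snoc q Q g ih =>
    obtain ⟨P', h₁, h₂⟩ := ih
    have key : ∃ g' : Gate ι (m + q), ∀ x,
        g'.eval x (P'.eval x) = g.eval (wire σ x) (Q.eval (wire σ x)) := by
      cases g with
      | not a =>
        obtain ⟨a', ha⟩ := Source.exists_wire σ h₂ a
        exact ⟨.not a', fun x => by simp [Gate.eval, ha]⟩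
      | and a b =>
        obtain ⟨a', ha⟩ := Source.exists_wire σ h₂ a
        obtain ⟨b', hb⟩ := Source.exists_wire σ h₂ b
        exact ⟨.and a' b', fun x => by simp [Gate.eval, ha, hb]⟩
      | or a b =>
        obtain ⟨a', ha⟩ := Source.exists_wire σ h₂ a
        obtain ⟨b', hb⟩ := Source.exists_wire σ h₂ b
        exact ⟨.or a' b', fun x => by simp [Gate.eval, ha, hb]⟩
    obtain ⟨g', hg⟩ := key
    refine ⟨P'.snoc g', fun φ hφ => (h₁ φ hφ).snoc _, fun j => ?_⟩
    refine Fin.lastCases ?_ (fun j => ?_) j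
    · simpa [Gates.eval, hg] using P'.computes_snoc g'
    · simpa [Gates.eval] using (h₂ j).snoc g'

theorem JointlyComputable.insert_circuit {t : ℕ} {Φ : Set ((ι → Bool) → Bool)}
    (h : JointlyComputable t Φ) (C : Circuit κ) (σ : κ → Source ι 0) :
    JointlyComputable (t + C.size) (insert (fun x => C.eval (wire σ x)) Φ) := by
  obtain ⟨m, hm, P, hP⟩ := h
  obtain ⟨P', h₁, h₂⟩ := P.exists_wire C.gates σ
  refine ⟨m + C.size, by omega, P', ?_⟩
  rintro ψ (rfl | hψ)
  · exact Source.exists_wire σ h₂ C.output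
  · exact h₁ ψ (hP ψ hψ)

theorem JointlyComputable.exists_circuit {t : ℕ} {Φ : Set ((ι → Bool) → Bool)}
    (h : JointlyComputable t Φ) {φ : (ι → Bool) → Bool} (hφ : φ ∈ Φ) :
    ∃ C : Circuit ι, C.size ≤ t ∧ ∀ x, C.eval x = φ x := by
  obtain ⟨m, hm, P, hP⟩ := h
  obtain ⟨a, ha⟩ := hP φ hφ
  exact ⟨⟨m, P, a⟩, hm, ha⟩

/-- The constant circuit, which has no gates. -/
def constCircuit (ι : Type*) (b : Bool) : Circuit ι := ⟨0, .nil, .const b⟩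

@[simp] theorem constCircuit_size (b : Bool) : (constCircuit ι b).size = 0 := rfl

/-! ### Branching programs -/

/-- Multiplexers with a common selector `β`: one negation, and three gates for each of them. -/
theorem JointlyComputable.union_mux {t : ℕ} {Φ : Set ((ι → Bool) → Bool)}
    (h : JointlyComputable t Φ) {β : (ι → Bool) → Bool} (hβ : β ∈ Φ) {K : Type*} (S : Finset K)
    {f g : K → (ι → Bool) → Bool} (hf : ∀ c ∈ S, f c ∈ Φ) (hg : ∀ c ∈ S, g c ∈ Φ) :
    JointlyComputable (t + 1 + 3 * S.card)
      (Φ ∪ (fun c x => bif β x then f c x else g c x) '' S) := by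
  classical
  suffices H : ∀ S' ⊆ S, JointlyComputable (t + 1 + 3 * S'.card)
      (insert (fun x => !β x) Φ ∪ (fun c x => bif β x then f c x else g c x) '' S') from
    (H S subset_rfl).mono le_rfl (Set.union_subset_union_left _ (Set.subset_insert _ _))
  intro S'
  induction S' using Finset.induction_on with
  | empty => intro _; simpa using h.insert_not hβ
  | insert c S' hc ih =>
    intro hS
    have h₀ := ih fun a ha => hS (Finset.mem_insert_of_mem ha)
    have hcS : c ∈ S := hS (Finset.mem_insert_self _ _)
    have h₁ := h₀.insert_and (φ := β) (χ := f c) (.inl (.inr hβ)) (.inl (.inr (hf c hcS)))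
    have h₂ := h₁.insert_and (φ := fun x => !β x) (χ := g c)
      (.inr (.inl (.inl rfl))) (.inr (.inl (.inr (hg c hcS))))
    have h₃ := h₂.insert_or (.inr (.inl rfl)) (.inl rfl)
    refine h₃.mono (by rw [Finset.card_insert_of_notMem hc]; omega) ?_
    have e : (fun x => bif β x then f c x else g c x)
        = fun x => (β x && f c x) || (!β x && g c x) := by
      funext x; cases β x <;> simp
    rw [Finset.coe_insert, Set.image_insert_eq]
    rintro ψ (hψ | rfl | hψ)
    · exact .inr (.inr (.inr (.inl hψ)))
    · rw [e]; exact .inl rfl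
    · exact .inr (.inr (.inr (.inr hψ)))

/-- An instruction of a branching program with states `Q`: apply a test to the input, and move to
a state that depends on the present state and the outcome. -/
structure Step (ι Q : Type*) where
  test : Circuit ι
  next : Q → Bool → Q

/-- The state reached from `a` by the branching program `L` on the input `x`. -/
def run {Q : Type*} (L : List (Step ι Q)) (a : Q) (x : ι → Bool) : Q :=
  L.foldl (fun a S => S.next a (S.test.eval x)) a

theorem run_append_singleton {Q : Type*} (L : List (Step ι Q)) (S : Step ι Q) (a : Q)
    (x : ι → Bool) : run (L ++ [S]) a x = S.next (run L a x) (S.test.eval x) := by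
  simp [run]

/-- A branching program is evaluated backwards: if the functions `H b c` give the answer once the
final state `b` is known, then each instruction, taken from last to first, costs one evaluation of
its test and one multiplexer for each state and each value of the passive parameter `c`. -/
theorem JointlyComputable.union_run {t s : ℕ} {Φ : Set ((ι → Bool) → Bool)}
    (h : JointlyComputable t Φ) {Q : Type*} [Fintype Q] {K : Type*} (S : Finset K)
    {H : Q → K → (ι → Bool) → Bool} (hH : ∀ b, ∀ c ∈ S, H b c ∈ Φ) (σ : κ → Source ι 0)
    (L : List (Step κ Q)) (hL : ∀ A ∈ L, A.test.size ≤ s) :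
    JointlyComputable (t + L.length * (s + 1 + 3 * (Fintype.card Q * S.card)))
      (Φ ∪ {ψ | ∃ b, ∃ c ∈ S, ψ = fun x => H (run L b (wire σ x)) c x}) := by
  induction L with
  | nil =>
    refine h.mono (by simp) ?_
    rintro ψ (hψ | ⟨b, c, hc, rfl⟩)
    · exact hψ
    · exact hH b c hc
  | cons A L ih =>
    have h₀ := ih fun B hB => hL B (List.mem_cons_of_mem _ hB)
    have h₁ := h₀.insert_circuit A.test σ
    have h₂ := h₁.union_mux (.inl rfl) (Finset.univ ×ˢ S)
      (f := fun p x => H (run L (A.next p.1 true) (wire σ x)) p.2 x)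
      (g := fun p x => H (run L (A.next p.1 false) (wire σ x)) p.2 x)
      (fun p hp => .inr (.inr ⟨A.next p.1 true, p.2, (Finset.mem_product.1 hp).2, rfl⟩))
      (fun p hp => .inr (.inr ⟨A.next p.1 false, p.2, (Finset.mem_product.1 hp).2, rfl⟩))
    refine h₂.mono ?_ ?_
    · have := hL A List.mem_cons_self
      rw [Finset.card_product, Finset.card_univ, List.length_cons, add_mul]
      omega
    · rintro ψ (hψ | ⟨b, c, hc, rfl⟩)
      · exact .inl (.inr (.inl hψ))
      · refine .inr ⟨(b, c), by simpa using hc, ?_⟩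
        funext x
        simp only [run, List.foldl_cons]
        cases A.test.eval (wire σ x) <;> rfl

/-- The sum of the weights of the states reached on the blocks of a tuple can be compared with
zero by a small circuit: the partial sums, which stay in `[-N, N]`, are the passive parameter of
`JointlyComputable.union_run`. -/
theorem jointlyComputable_weightSum {s k : ℕ} {Q : Type*} [Fintype Q] (L : List (Step κ Q))
    (hL : ∀ A ∈ L, A.test.size ≤ s) (a : Q) (w : Q → ℤ) (W N : ℕ) (hw : ∀ b, |w b| ≤ W)
    (l : List (Fin k)) :
    JointlyComputable
      (l.length * (L.length * (s + 1 + 3 * (Fintype.card Q * (2 * N + 1)))))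
      {ψ : (Fin k × κ → Bool) → Bool | ∃ c : ℤ, |c| + l.length * W ≤ N ∧
        ψ = fun x => decide (0 ≤ c + (l.map fun i => w (run L a fun j => x (i, j))).sum)} := by
  induction l with
  | nil =>
    refine jointlyComputable_const.mono (by simp) ?_
    rintro ψ ⟨c, -, rfl⟩
    exact ⟨decide (0 ≤ c), by simp⟩
  | cons i l ih =>
    let S : Finset ℤ := {c ∈ Finset.Icc (-N : ℤ) N | |c| + ((l.length : ℤ) + 1) * W ≤ N}
    have h := ih.union_run S
      (H := fun b c x =>
        decide (0 ≤ c + w b + (l.map fun i => w (run L a fun j => x (i, j))).sum))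
      (fun b c hc => ⟨c + w b, by
        have h₁ := (Finset.mem_filter.1 hc).2
        have h₂ := abs_add_le c (w b)
        have h₃ := hw b
        linarith, rfl⟩)
      (fun j => .input (i, j)) L hL
    refine h.mono ?_ ?_
    · have hc : S.card ≤ 2 * N + 1 := by
        refine (Finset.card_filter_le _ _).trans ?_
        rw [Int.card_Icc]; omega
      rw [List.length_cons, add_mul, one_mul]
      gcongr
    · rintro ψ ⟨c, hc, rfl⟩
      refine .inr ⟨a, c, ?_, ?_⟩
      · push_cast [List.length_cons] at hc
        have h₀ : (0 : ℤ) ≤ (l.length + 1) * W := by positivity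
        have h₁ := abs_le.1 (show |c| ≤ N by linarith)
        exact Finset.mem_filter.2 ⟨Finset.mem_Icc.2 h₁, hc⟩
      · funext x
        simp only [List.map_cons, List.sum_cons, ← add_assoc]
        rfl

/-! ### Sums over product measures -/

section Product

variable {𝒳 : Type*} [Fintype 𝒳]

theorem sum_tuple_succ {k : ℕ} (F : (Fin (k + 1) → 𝒳) → ℝ) :
    ∑ x, F x = ∑ a, ∑ y : Fin k → 𝒳, F (Fin.cons a y) := by
  rw [← Fintype.sum_prod_type']
  exact (Fintype.sum_equiv (Fin.consEquiv fun _ => 𝒳) _ _ fun _ => rfl).symm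

theorem sum_tuple_prod_le_one {μ : 𝒳 → ℝ} (h₀ : ∀ a, 0 ≤ μ a) (h₁ : ∑ a, μ a ≤ 1) (k : ℕ) :
    ∑ x : Fin k → 𝒳, ∏ i, μ (x i) ≤ 1 := by
  rw [← Fintype.sum_pow]
  exact pow_le_one₀ (Finset.sum_nonneg fun a _ => h₀ a) h₁

/-- The `L¹` distance of two product measures is at most the sum of the distances of the factors,
as one sees by exchanging the factors one at a time. -/
theorem sum_abs_prod_sub_prod_le {μ ν : 𝒳 → ℝ} (hμ₀ : ∀ a, 0 ≤ μ a) (hμ₁ : ∑ a, μ a ≤ 1)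
    (hν₀ : ∀ a, 0 ≤ ν a) (hν₁ : ∑ a, ν a ≤ 1) (k : ℕ) :
    ∑ x : Fin k → 𝒳, |∏ i, μ (x i) - ∏ i, ν (x i)| ≤ k * ∑ a, |μ a - ν a| := by
  induction k with
  | zero => simp
  | succ k ih =>
    rw [sum_tuple_succ]
    simp only [Fin.prod_univ_succ, Fin.cons_zero, Fin.cons_succ]
    calc ∑ a, ∑ y : Fin k → 𝒳, |μ a * ∏ i, μ (y i) - ν a * ∏ i, ν (y i)|
        ≤ ∑ a, ∑ y : Fin k → 𝒳, (|μ a - ν a| * ∏ i, μ (y i)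
            + ν a * |∏ i, μ (y i) - ∏ i, ν (y i)|) := by
          gcongr with a _ y _
          have h₁ : 0 ≤ ∏ i, μ (y i) := Finset.prod_nonneg fun i _ => hμ₀ _
          calc |μ a * ∏ i, μ (y i) - ν a * ∏ i, ν (y i)|
              = |(μ a - ν a) * ∏ i, μ (y i) + ν a * (∏ i, μ (y i) - ∏ i, ν (y i))| := by
                congr 1; ring
            _ ≤ _ := by
                refine (abs_add_le _ _).trans_eq ?_
                rw [abs_mul, abs_mul, abs_of_nonneg h₁, abs_of_nonneg (hν₀ a)]
      _ = (∑ a, |μ a - ν a|) * ∑ y : Fin k → 𝒳, ∏ i, μ (y i)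
            + (∑ a, ν a) * ∑ y : Fin k → 𝒳, |∏ i, μ (y i) - ∏ i, ν (y i)| := by
          simp only [Finset.sum_add_distrib, Finset.sum_mul_sum]
      _ ≤ (∑ a, |μ a - ν a|) * 1 + 1 * (k * ∑ a, |μ a - ν a|) := by
          have h : 0 ≤ ∑ a, |μ a - ν a| := Finset.sum_nonneg fun _ _ => abs_nonneg _
          gcongr
          exact sum_tuple_prod_le_one hμ₀ hμ₁ k
      _ = _ := by push_cast; ring

/-- Exchanging the factors one at a time, for the advantage of a test `G`: it suffices to bound the
advantage of the tests obtained from `G` by fixing all coordinates but one. -/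
theorem abs_sum_mul_prod_sub_prod_le [DecidableEq 𝒳] {μ ν : 𝒳 → ℝ} (hμ₀ : ∀ a, 0 ≤ μ a)
    (hμ₁ : ∑ a, μ a ≤ 1) (hν₀ : ∀ a, 0 ≤ ν a) (hν₁ : ∑ a, ν a ≤ 1) {δ : ℝ} (hδ : 0 ≤ δ) (k : ℕ)
    (G : (Fin k → 𝒳) → ℝ)
    (hG : ∀ i x, |∑ a, G (Function.update x i a) * (μ a - ν a)| ≤ δ) :
    |∑ x, G x * (∏ i, μ (x i) - ∏ i, ν (x i))| ≤ k * δ := by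
  induction k with
  | zero => simp
  | succ k ih =>
    rw [sum_tuple_succ]
    simp only [Fin.prod_univ_succ, Fin.cons_zero, Fin.cons_succ]
    have e : ∑ a, ∑ y : Fin k → 𝒳, G (Fin.cons a y) * (μ a * ∏ i, μ (y i) - ν a * ∏ i, ν (y i))
        = ∑ y : Fin k → 𝒳, (∏ i, μ (y i)) * ∑ a, G (Fin.cons a y) * (μ a - ν a)
          + ∑ a, ν a * ∑ y : Fin k → 𝒳, G (Fin.cons a y) * (∏ i, μ (y i) - ∏ i, ν (y i)) := by
      simp only [Finset.mul_sum]
      rw [Finset.sum_comm (s := (Finset.univ : Finset (Fin k → 𝒳))), ← Finset.sum_add_distrib]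
      refine Finset.sum_congr rfl fun a _ => ?_
      rw [← Finset.sum_add_distrib]
      exact Finset.sum_congr rfl fun y _ => by ring
    rw [e]
    have h₁ : |∑ y : Fin k → 𝒳, (∏ i, μ (y i)) * ∑ a, G (Fin.cons a y) * (μ a - ν a)| ≤ δ := by
      calc _ ≤ ∑ y : Fin k → 𝒳, (∏ i, μ (y i)) * δ := by
            refine (Finset.abs_sum_le_sum_abs _ _).trans (Finset.sum_le_sum fun y _ => ?_)
            have hp : 0 ≤ ∏ i, μ (y i) := Finset.prod_nonneg fun i _ => hμ₀ _
            rw [abs_mul, abs_of_nonneg hp]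
            gcongr
            rcases isEmpty_or_nonempty 𝒳 with h | ⟨⟨b⟩⟩
            · simpa using hδ
            · simpa using hG 0 (Fin.cons b y)
        _ ≤ δ := by
            rw [← Finset.sum_mul]
            exact mul_le_of_le_one_left hδ (sum_tuple_prod_le_one hμ₀ hμ₁ k)
    have h₂ : |∑ a, ν a * ∑ y : Fin k → 𝒳, G (Fin.cons a y) * (∏ i, μ (y i) - ∏ i, ν (y i))|
        ≤ k * δ := by
      calc _ ≤ ∑ a, ν a * (k * δ) := by
            refine (Finset.abs_sum_le_sum_abs _ _).trans (Finset.sum_le_sum fun a _ => ?_)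
            rw [abs_mul, abs_of_nonneg (hν₀ a)]
            gcongr
            · exact hν₀ a
            · refine ih (fun y => G (Fin.cons a y)) fun i y => ?_
              simpa [Fin.cons_update] using hG i.succ (Fin.cons a y)
        _ ≤ k * δ := by
            rw [← Finset.sum_mul]
            exact mul_le_of_le_one_left (by positivity) hν₁
    calc _ ≤ δ + k * δ := (abs_add_le _ _).trans (add_le_add h₁ h₂)
      _ = _ := by push_cast; ring

/-- Measures that give the same mass to the fibres of `ℓ` have powers that agree on all functions
of the labels. -/
theorem sum_mul_prod_eq_of_fiber_sum_eq {Q : Type*} [Fintype Q] [DecidableEq Q] {μ ν : 𝒳 → ℝ}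
    (ℓ : 𝒳 → Q) (h : ∀ q, ∑ a with ℓ a = q, μ a = ∑ a with ℓ a = q, ν a) {k : ℕ}
    (G : (Fin k → Q) → ℝ) :
    ∑ x : Fin k → 𝒳, G (fun i => ℓ (x i)) * ∏ i, μ (x i)
      = ∑ x : Fin k → 𝒳, G (fun i => ℓ (x i)) * ∏ i, ν (x i) := by
  classical
  have key : ∀ θ : 𝒳 → ℝ, ∑ x : Fin k → 𝒳, G (fun i => ℓ (x i)) * ∏ i, θ (x i)
      = ∑ q : Fin k → Q, G q * ∏ i, ∑ a with ℓ a = q i, θ a := by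
    intro θ
    rw [← Finset.sum_fiberwise (s := Finset.univ) (g := fun (x : Fin k → 𝒳) i => ℓ (x i))]
    refine Finset.sum_congr rfl fun q _ => ?_
    rw [Finset.prod_univ_sum, Finset.mul_sum]
    refine Finset.sum_congr ?_ fun x hx => ?_
    · ext x; simp [funext_iff]
    · have : (fun i => ℓ (x i)) = q := by ext i; simpa using Fintype.mem_piFinset.1 hx i
      rw [this]
  rw [key, key]
  simp only [h]

end Product

/-! ### Distributions as real functions -/

/-- Fixing all coordinates but one of a test on tuples amounts to wiring the corresponding input
bits to constants, which costs no gates. -/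
theorem ComputableBySize.update {𝒳 ι : Type*} {enc : 𝒳 → ι → Bool} {s : ℝ} {k : ℕ}
    {f : (Fin k → 𝒳) → Bool} (hf : ComputableBySize (encTuple enc k) s f) (i : Fin k)
    (x : Fin k → 𝒳) : ComputableBySize enc s fun a => f (Function.update x i a) := by
  obtain ⟨C, hC, hCf⟩ := hf
  obtain ⟨C', hC', h⟩ := (jointlyComputable_empty.insert_circuit C fun p : Fin k × ι =>
    if p.1 = i then Source.input p.2 else .const (enc (x p.1) p.2)).exists_circuit (.inl rfl)
  refine ⟨C', le_trans (by exact_mod_cast by omega) hC, fun a => ?_⟩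
  refine (h _).trans (Eq.trans ?_ (hCf _))
  congr 1
  funext p
  simp only [wire, encTuple]
  by_cases hp : p.1 = i
  · rw [if_pos hp, hp, Function.update_self]; rfl
  · rw [if_neg hp, Function.update_of_ne hp]; rfl

section Distribution

variable {𝒳 : Type*} [Fintype 𝒳]

theorem sum_toReal_eq_one (X : PMF 𝒳) : ∑ a, (X a).toReal = 1 := by
  have h : ∑ a, X a = 1 := by
    rw [← tsum_fintype (L := .unconditional _)]; exact X.tsum_coe
  rw [← ENNReal.toReal_sum fun a _ => X.apply_ne_top a, h, ENNReal.toReal_one]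

theorem toReal_iid (X : PMF 𝒳) {k : ℕ} (x : Fin k → 𝒳) :
    (iid X k x).toReal = ∏ i, (X (x i)).toReal := by
  simp [iid, ENNReal.toReal_prod]

theorem exists_pmf_toReal_eq {y : 𝒳 → ℝ} (h₀ : ∀ a, 0 ≤ y a) (h₁ : ∑ a, y a = 1) :
    ∃ Y : PMF 𝒳, ∀ a, (Y a).toReal = y a := by
  refine ⟨PMF.ofFintype (fun a => ENNReal.ofReal (y a)) ?_, fun a => ?_⟩
  · rw [← ENNReal.ofReal_sum_of_nonneg fun a _ => h₀ a, h₁, ENNReal.ofReal_one]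
  · simp [h₀ a]

theorem dTV_eq_sum_posPart (X Y : PMF 𝒳) :
    dTV X Y = ∑ a, max ((X a).toReal - (Y a).toReal) 0 := by
  have h : ∑ a, ((X a).toReal - (Y a).toReal) = 0 := by
    rw [Finset.sum_sub_distrib, sum_toReal_eq_one, sum_toReal_eq_one, sub_self]
  have e : ∀ r : ℝ, max r 0 = 1 / 2 * |r| + 1 / 2 * r := by
    intro r
    rcases le_total 0 r with hr | hr
    · rw [max_eq_left hr, abs_of_nonneg hr]; ring
    · rw [max_eq_right hr, abs_of_nonpos hr]; ring
  simp only [e, Finset.sum_add_distrib, ← Finset.mul_sum, h, dTV]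
  ring

theorem advantage_nonneg (f : 𝒳 → Bool) (X Y : PMF 𝒳) : 0 ≤ advantage f X Y := abs_nonneg _

theorem advantage_le_dTV (f : 𝒳 → Bool) (X Y : PMF 𝒳) : advantage f X Y ≤ dTV X Y := by
  have key : ∀ X Y : PMF 𝒳,
      ∑ x, (if f x then 1 else 0) * ((X x).toReal - (Y x).toReal) ≤ dTV X Y := by
    intro X Y
    rw [dTV_eq_sum_posPart]
    refine Finset.sum_le_sum fun a _ => ?_
    split_ifs <;> simp
  have hc : dTV Y X = dTV X Y := by simp only [dTV, abs_sub_comm]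
  refine abs_le'.2 ⟨key X Y, ?_⟩
  rw [← hc, ← Finset.sum_neg_distrib]
  refine (Finset.sum_le_sum fun a _ => ?_).trans (key Y X)
  exact le_of_eq (by ring)

theorem advantage_triangle (f : 𝒳 → Bool) (X Y Z : PMF 𝒳) :
    advantage f X Z ≤ advantage f X Y + advantage f Y Z := by
  unfold advantage
  refine le_trans (le_of_eq ?_) (abs_add_le _ _)
  rw [← Finset.sum_add_distrib]
  congr 1
  exact Finset.sum_congr rfl fun a _ => by ring

theorem dTV_le_one (X Y : PMF 𝒳) : dTV X Y ≤ 1 := by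
  rw [dTV_eq_sum_posPart, ← sum_toReal_eq_one X]
  exact Finset.sum_le_sum fun a _ => max_le (by simp) (by simp)

theorem indistinguishable_self {ι : Type*} (enc : 𝒳 → ι → Bool) (s : ℝ) {δ : ℝ} (hδ : 0 ≤ δ)
    (X : PMF 𝒳) : Indistinguishable enc s δ X X := by
  intro f _
  simpa [advantage] using hδ

/-- Indistinguishability of single samples passes to `k` samples: exchange the samples one at a
time, and fix the others in the best way. -/
theorem Indistinguishable.iid {ι : Type*} {enc : 𝒳 → ι → Bool} {s δ : ℝ} (hδ : 0 ≤ δ)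
    {X Y : PMF 𝒳} (h : Indistinguishable enc s δ X Y) (k : ℕ) :
    Indistinguishable (encTuple enc k) s (k * δ) (iid X k) (iid Y k) := by
  classical
  intro f hf
  simp only [advantage, toReal_iid]
  exact abs_sum_mul_prod_sub_prod_le (fun _ => ENNReal.toReal_nonneg) (sum_toReal_eq_one X).le
    (fun _ => ENNReal.toReal_nonneg) (sum_toReal_eq_one Y).le hδ k (fun x => if f x then 1 else 0)
    fun i x => h _ (hf.update i x)

theorem Distinguishable.mono {ι : Type*} {enc : 𝒳 → ι → Bool} {s s' δ δ' : ℝ}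
    {X Y : PMF 𝒳} (h : Distinguishable enc s δ X Y) (hs : s ≤ s') (hδ : δ' ≤ δ) :
    Distinguishable enc s' δ' X Y := by
  obtain ⟨f, ⟨C, hC, hCf⟩, hf⟩ := h
  exact ⟨f, ⟨C, hC.trans hs, hCf⟩, hδ.trans hf⟩

end Distribution

/-! ### A multicalibrated partition -/

section Partition

variable {𝒳 ι : Type*} [Fintype 𝒳] {M : ℕ}

/-- The prediction attached to the level `a`: an estimate of the conditional probability that a
sample from the even mixture of two distributions came from the first one. -/
noncomputable def levelValue (a : Fin (M + 1)) : ℝ := a / M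

/-- Where the test `β` accepts, move one level up or down, according to the sign `σ` chosen for the
present level, but stay within the range. -/
def moveLevel (σ : Fin (M + 1) → Bool) (a : Fin (M + 1)) (β : Bool) : Fin (M + 1) :=
  if β then
    if σ a then ⟨min (a + 1) M, by omega⟩ else ⟨a - 1, by omega⟩
  else a

/-- The sign `1` or `-1` that `b` stands for. -/
def boolSign (b : Bool) : ℝ := if b then 1 else -1

/-- The effect of a move on the squared error at one point. The bound is an equality except at the
ends of the range, where the level stays and the other terms are nonnegative in total. -/
theorem squaredError_moveLevel_le (hM : 0 < M) (σ : Fin (M + 1) → Bool) (a : Fin (M + 1))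
    (β : Bool) {p q : ℝ} (hp : 0 ≤ p) (hq : 0 ≤ q) :
    p * (1 - levelValue (moveLevel σ a β)) ^ 2 + q * levelValue (moveLevel σ a β) ^ 2
      ≤ p * (1 - levelValue a) ^ 2 + q * levelValue a ^ 2
        - 2 / M * (boolSign (σ a) * ((if β then 1 else 0)
          * ((1 - levelValue a) * p - levelValue a * q))) + (p + q) / M ^ 2 := by
  have hM' : (0 : ℝ) < M := by exact_mod_cast hM
  unfold moveLevel boolSign
  cases β with
  | false =>
    have : 0 ≤ (p + q) / (M : ℝ) ^ 2 := by positivity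
    simpa using this
  | true =>
    cases hσ : σ a with
    | true =>
      simp only [if_true]
      rcases Nat.lt_or_ge (a : ℕ) M with h | h
      · have e : levelValue (⟨min (a + 1) M, by omega⟩ : Fin (M + 1)) = levelValue a + 1 / M := by
          simp only [levelValue, min_eq_left (Nat.succ_le_of_lt h)]
          push_cast; ring
        rw [e]
        apply le_of_eq
        field_simp
        ring
      · have e : (⟨min (a + 1) M, by omega⟩ : Fin (M + 1)) = a := Fin.ext (by simp; omega)
        have e' : levelValue a = 1 := by
          have : (a : ℕ) = M := by omega
          rw [levelValue, this, div_self hM'.ne']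
        rw [e, e']
        have h₁ : 0 ≤ 2 / (M : ℝ) * q := by positivity
        have h₂ : 0 ≤ (p + q) / (M : ℝ) ^ 2 := by positivity
        linarith
    | false =>
      simp only [if_true, Bool.false_eq_true, if_false]
      rcases Nat.eq_zero_or_pos (a : ℕ) with h | h
      · have e : (⟨a - 1, by omega⟩ : Fin (M + 1)) = a := Fin.ext (by simp; omega)
        have e' : levelValue a = 0 := by rw [levelValue, h]; simp
        rw [e, e']
        have h₁ : 0 ≤ 2 / (M : ℝ) * p := by positivity
        have h₂ : 0 ≤ (p + q) / (M : ℝ) ^ 2 := by positivity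
        linarith
      · have e : levelValue (⟨a - 1, by omega⟩ : Fin (M + 1)) = levelValue a - 1 / M := by
          simp only [levelValue]
          rw [Nat.cast_sub h]
          push_cast; ring
        rw [e]
        apply le_of_eq
        field_simp
        ring

/-- The squared error of the predictor `ℓ`, summed over the two distributions. -/
noncomputable def squaredError (p q : 𝒳 → ℝ) (ℓ : 𝒳 → Fin (M + 1)) : ℝ :=
  ∑ x, (p x * (1 - levelValue (ℓ x)) ^ 2 + q x * levelValue (ℓ x) ^ 2)

/-- The imbalance that the test `f` detects, when the levels are given the signs `σ`. -/
noncomputable def imbalance (p q : 𝒳 → ℝ) (ℓ : 𝒳 → Fin (M + 1)) (σ : Fin (M + 1) → Bool)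
    (f : 𝒳 → Bool) : ℝ :=
  ∑ x, boolSign (σ (ℓ x)) * ((if f x then 1 else 0)
    * ((1 - levelValue (ℓ x)) * p x - levelValue (ℓ x) * q x))

theorem squaredError_moveLevel_lt {p q : 𝒳 → ℝ} (hp₀ : ∀ x, 0 ≤ p x) (hp₁ : ∑ x, p x = 1)
    (hq₀ : ∀ x, 0 ≤ q x) (hq₁ : ∑ x, q x = 1) (hM : 0 < M) (ℓ : 𝒳 → Fin (M + 1))
    (σ : Fin (M + 1) → Bool) (f : 𝒳 → Bool) (h : 2 / M < imbalance p q ℓ σ f) :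
    squaredError p q (fun x => moveLevel σ (ℓ x) (f x)) < squaredError p q ℓ - 2 / M ^ 2 := by
  have hM' : (0 : ℝ) < M := by exact_mod_cast hM
  have h₁ : squaredError p q (fun x => moveLevel σ (ℓ x) (f x))
      ≤ squaredError p q ℓ - 2 / M * imbalance p q ℓ σ f + 2 / M ^ 2 := by
    refine (Finset.sum_le_sum fun x _ =>
      squaredError_moveLevel_le hM σ (ℓ x) (f x) (hp₀ x) (hq₀ x)).trans_eq ?_
    have hpq : ∑ x, (p x + q x) = 2 := by rw [Finset.sum_add_distrib, hp₁, hq₁]; norm_num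
    rw [Finset.sum_add_distrib, Finset.sum_sub_distrib, ← Finset.mul_sum, ← Finset.sum_div, hpq]
    rfl
  have h₂ : 2 / (M : ℝ) * (2 / M) < 2 / M * imbalance p q ℓ σ f := by gcongr
  have h₃ : 2 / (M : ℝ) * (2 / M) = 2 / M ^ 2 + 2 / M ^ 2 := by ring
  linarith

/-- Energy decrement: as long as some test with signs on the levels detects a considerable
imbalance, moving along this test lowers the squared error by `2 / M ^ 2`, and it was at most `2`
in the beginning. -/
theorem exists_steps_imbalance_le {p q : 𝒳 → ℝ} (hp₀ : ∀ x, 0 ≤ p x) (hp₁ : ∑ x, p x = 1)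
    (hq₀ : ∀ x, 0 ≤ q x) (hq₁ : ∑ x, q x = 1) (hM : 0 < M) (enc : 𝒳 → ι → Bool) (s : ℕ) :
    ∃ L : List (Step ι (Fin (M + 1))), L.length ≤ M ^ 2 + 1 ∧ (∀ A ∈ L, A.test.size ≤ s) ∧
      ∀ C : Circuit ι, C.size ≤ s → ∀ σ,
        imbalance p q (fun x => run L 0 (enc x)) σ (fun x => C.eval (enc x)) ≤ 2 / M := by
  by_contra! hcon
  have hM' : (0 : ℝ) < M := by exact_mod_cast hM
  have key : ∀ n ≤ M ^ 2 + 1, ∃ L : List (Step ι (Fin (M + 1))), L.length = n ∧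
      (∀ A ∈ L, A.test.size ≤ s) ∧
      squaredError p q (fun x => run L 0 (enc x)) ≤ 2 - n * (2 / M ^ 2) := by
    intro n
    induction n with
    | zero =>
      intro _
      refine ⟨[], rfl, by simp, ?_⟩
      have : squaredError p q (fun x => run [] (0 : Fin (M + 1)) (enc x)) = 1 := by
        simp [squaredError, run, levelValue, hp₁]
      rw [this]; norm_num
    | succ n ih =>
      intro hn
      obtain ⟨L, hL, hLs, hE⟩ := ih (by omega)
      obtain ⟨C, hC, σ, hσ⟩ := hcon L (by omega) hLs
      refine ⟨L ++ [⟨C, moveLevel σ⟩], by simp [hL], ?_, ?_⟩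
      · intro A hA
        rcases List.mem_append.1 hA with hA | hA
        · exact hLs A hA
        · rw [List.mem_singleton.1 hA]; exact hC
      · simp only [run_append_singleton]
        have := squaredError_moveLevel_lt hp₀ hp₁ hq₀ hq₁ hM _ σ _ hσ
        push_cast
        linarith
  obtain ⟨L, -, -, hE⟩ := key (M ^ 2 + 1) le_rfl
  have h₀ : 0 ≤ squaredError p q (fun x => run L 0 (enc x)) :=
    Finset.sum_nonneg fun x _ => add_nonneg (mul_nonneg (hp₀ x) (sq_nonneg _))
      (mul_nonneg (hq₀ x) (sq_nonneg _))
  have h₁ : ((M ^ 2 + 1 : ℕ) : ℝ) * (2 / M ^ 2) = 2 + 2 / M ^ 2 := by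
    push_cast; field_simp
  have h₂ : 0 < 2 / (M : ℝ) ^ 2 := by positivity
  linarith

/-- The mass that `p` gives to the part of `f` that lies in the cell `a` of `ℓ`. -/
noncomputable def cellSum {Q : Type*} [DecidableEq Q] (ℓ : 𝒳 → Q) (p : 𝒳 → ℝ) (f : 𝒳 → Bool)
    (a : Q) : ℝ :=
  ∑ x with ℓ x = a, (if f x then 1 else 0) * p x

/-- The partition into levels, with the imbalances of all cells added up in absolute value: the
signs are free, so they can be chosen to make every term of the sum nonnegative. -/
theorem exists_steps_sum_abs_cellSum_le {p q : 𝒳 → ℝ} (hp₀ : ∀ x, 0 ≤ p x) (hp₁ : ∑ x, p x = 1)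
    (hq₀ : ∀ x, 0 ≤ q x) (hq₁ : ∑ x, q x = 1) (hM : 0 < M) (enc : 𝒳 → ι → Bool) (s : ℕ) :
    ∃ L : List (Step ι (Fin (M + 1))), L.length ≤ M ^ 2 + 1 ∧ (∀ A ∈ L, A.test.size ≤ s) ∧
      ∀ f : 𝒳 → Bool, ComputableBySize enc s f →
        ∑ a, |(1 - levelValue a) * cellSum (fun x => run L 0 (enc x)) p f a
          - levelValue a * cellSum (fun x => run L 0 (enc x)) q f a| ≤ 2 / M := by
  obtain ⟨L, h₁, h₂, h₃⟩ := exists_steps_imbalance_le hp₀ hp₁ hq₀ hq₁ hM enc s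
  refine ⟨L, h₁, h₂, ?_⟩
  rintro f ⟨C, hC, hCf⟩
  set ℓ : 𝒳 → Fin (M + 1) := fun x => run L 0 (enc x) with hℓ
  refine le_trans (le_of_eq ?_) (h₃ C (by exact_mod_cast hC) fun a =>
    decide (0 ≤ (1 - levelValue a) * cellSum ℓ p f a - levelValue a * cellSum ℓ q f a))
  simp only [hCf, imbalance]
  rw [← Finset.sum_fiberwise (s := Finset.univ) (g := ℓ)]
  refine Finset.sum_congr rfl fun a _ => ?_
  have e : (1 - levelValue a) * cellSum ℓ p f a - levelValue a * cellSum ℓ q f a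
      = ∑ x with ℓ x = a, (if f x then 1 else 0)
        * ((1 - levelValue a) * p x - levelValue a * q x) := by
    simp only [cellSum, Finset.mul_sum]
    rw [← Finset.sum_sub_distrib]
    exact Finset.sum_congr rfl fun x _ => by ring
  have e' : ∀ r : ℝ, |r| = boolSign (decide (0 ≤ r)) * r := by
    intro r
    by_cases hr : 0 ≤ r
    · simp [boolSign, hr, abs_of_nonneg hr]
    · simp [boolSign, hr, abs_of_neg (not_le.1 hr)]
  rw [e']
  conv_lhs => enter [2]; rw [e]
  rw [Finset.mul_sum]
  refine Finset.sum_congr rfl fun x hx => ?_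
  rw [← (Finset.mem_filter.1 hx).2]

end Partition

/-! ### Tests given by integer weights -/

/-- The odds `ρ ^ w`, with `ρ = 1 + 1 / N`, give a grid of probabilities of mesh `1 / N` in the
unit interval already for `|w| ≤ N ^ 2`. -/
theorem exists_zpow_odds_close {N : ℕ} (hN : 0 < N) {v : ℝ} (hv₀ : 0 ≤ v) (hv₁ : v ≤ 1) :
    ∃ w : ℤ, |w| ≤ (N ^ 2 : ℕ) ∧
      |(1 + 1 / N : ℝ) ^ w / (1 + (1 + 1 / N : ℝ) ^ w) - v| ≤ 1 / N := by
  have hN' : (0 : ℝ) < N := by exact_mod_cast hN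
  set ρ : ℝ := 1 + 1 / N with hρ
  have hρ₀ : 0 < ρ := by positivity
  set g : ℕ → ℝ := fun i => ρ ^ ((i : ℤ) - (N ^ 2 : ℕ)) / (1 + ρ ^ ((i : ℤ) - (N ^ 2 : ℕ))) with hg
  have hbig : 1 + (N : ℝ) ≤ ρ ^ (N ^ 2) := by
    have h := one_add_mul_le_pow (a := 1 / (N : ℝ)) (by
      have : 0 < 1 / (N : ℝ) := by positivity
      linarith) (N ^ 2)
    have e : ((N ^ 2 : ℕ) : ℝ) * (1 / N) = N := by push_cast; field_simp
    rwa [e] at h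
  have hB : 1 / (1 + ρ ^ (N ^ 2)) ≤ 1 / N := by
    gcongr
    linarith
  have hfirst : g 0 ≤ 1 / N := by
    refine le_trans (le_of_eq ?_) hB
    simp only [hg, Nat.cast_zero, zero_sub, zpow_neg, zpow_natCast]
    have : 0 < ρ ^ (N ^ 2) := by positivity
    field_simp
    ring
  have hlast : 1 - 1 / N ≤ g (2 * N ^ 2) := by
    have e : ((2 * N ^ 2 : ℕ) : ℤ) - (N ^ 2 : ℕ) = (N ^ 2 : ℕ) := by push_cast; ring
    have e' : g (2 * N ^ 2) = 1 - 1 / (1 + ρ ^ (N ^ 2)) := by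
      simp only [hg, e, zpow_natCast]
      have : 0 < ρ ^ (N ^ 2) := by positivity
      field_simp
      ring
    rw [e']
    linarith
  have hstep : ∀ i, g (i + 1) ≤ g i + 1 / N := by
    intro i
    have e : ((i + 1 : ℕ) : ℤ) - (N ^ 2 : ℕ) = ((i : ℤ) - (N ^ 2 : ℕ)) + 1 := by push_cast; ring
    simp only [hg, e, zpow_add_one₀ hρ₀.ne']
    set r : ℝ := ρ ^ ((i : ℤ) - (N ^ 2 : ℕ)) with hr
    have hr₀ : 0 < r := by positivity
    have hd : r * ρ / (1 + r * ρ) - r / (1 + r) = r / (1 + r) * (1 / (1 + r * ρ)) * (1 / N) := by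
      have : ρ - 1 = 1 / N := by rw [hρ]; ring
      rw [← this]
      field_simp
      ring
    have h₁ : r / (1 + r) ≤ 1 := div_le_one_of_le₀ (by linarith) (by linarith)
    have h₂ : 1 / (1 + r * ρ) ≤ 1 := div_le_one_of_le₀ (by nlinarith) (by positivity)
    have h₃ : r / (1 + r) * (1 / (1 + r * ρ)) * (1 / N) ≤ 1 * 1 * (1 / N) := by gcongr
    linarith
  have hN₁ : 0 < 1 / (N : ℝ) := by positivity
  have key : ∀ n, (∃ i ≤ n, |g i - v| ≤ 1 / N) ∨ g n < v := by
    intro n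
    induction n with
    | zero =>
      rcases lt_or_ge (g 0) v with h | h
      · exact .inr h
      · exact .inl ⟨0, le_rfl, abs_le.2 ⟨by linarith, by linarith⟩⟩
    | succ n ih =>
      rcases ih with ⟨i, hi, h⟩ | h
      · exact .inl ⟨i, by omega, h⟩
      · rcases lt_or_ge (g (n + 1)) v with h' | h'
        · exact .inr h'
        · have := hstep n
          exact .inl ⟨n + 1, le_rfl, abs_le.2 ⟨by linarith, by linarith⟩⟩
  have hex : ∃ i ≤ 2 * N ^ 2, |g i - v| ≤ 1 / N := by
    rcases key (2 * N ^ 2) with h | h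
    · exact h
    · exact ⟨_, le_rfl, abs_le.2 ⟨by linarith, by linarith⟩⟩
  obtain ⟨i, hi, h⟩ := hex
  exact ⟨(i : ℤ) - (N ^ 2 : ℕ), abs_le.2 ⟨by omega, by omega⟩, h⟩

section Weights

variable {𝒳 : Type*} [Fintype 𝒳]

/-- Normalizing a perturbation of `t` to a measure of mass at most `1`. -/
theorem sum_div_perturbation {t t' E : 𝒳 → ℝ} {η : ℝ} (hη : 0 ≤ η) (ht : ∑ x, t x ≤ 1)
    (hE : ∑ x, E x ≤ 2) (ht' : ∀ x, 0 ≤ t' x) (h : ∀ x, |t' x - t x| ≤ η * E x) :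
    ∑ x, t' x / (1 + 2 * η) ≤ 1 ∧ ∑ x, |t' x / (1 + 2 * η) - t x| ≤ 4 * η := by
  have hs : ∑ x, t' x ≤ 1 + 2 * η := by
    calc ∑ x, t' x ≤ ∑ x, (t x + η * E x) :=
          Finset.sum_le_sum fun x _ => by linarith [(abs_le.1 (h x)).2]
      _ = ∑ x, t x + η * ∑ x, E x := by rw [Finset.sum_add_distrib, Finset.mul_sum]
      _ ≤ 1 + η * 2 := by gcongr
      _ = _ := by ring
  have hpos : 0 < 1 + 2 * η := by linarith
  have h₁ : ∑ x, t' x / (1 + 2 * η) ≤ 1 := by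
    rw [← Finset.sum_div]
    exact div_le_one_of_le₀ hs hpos.le
  refine ⟨h₁, ?_⟩
  calc ∑ x, |t' x / (1 + 2 * η) - t x|
      ≤ ∑ x, (2 * η * (t' x / (1 + 2 * η)) + η * E x) := by
        refine Finset.sum_le_sum fun x _ => (abs_sub_le _ (t' x) _).trans (add_le_add ?_ (h x))
        have e : t' x / (1 + 2 * η) - t' x = -(2 * η * (t' x / (1 + 2 * η))) := by
          field_simp; ring
        have : 0 ≤ t' x / (1 + 2 * η) := div_nonneg (ht' x) hpos.le
        rw [e, abs_neg, abs_of_nonneg (by positivity)]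
    _ = 2 * η * ∑ x, t' x / (1 + 2 * η) + η * ∑ x, E x := by
        rw [Finset.sum_add_distrib, Finset.mul_sum, Finset.mul_sum]
    _ ≤ 2 * η * 1 + η * 2 := by gcongr
    _ = 4 * η := by ring

/-- If the likelihood ratio of `Y` and `X` is close to `v / (1 - v)`, and `v / (1 - v)` is close to
the power `ρ ^ w`, then the test for a nonnegative sum of the weights `w` is nearly optimal for
telling `k` samples from `Y` from `k` samples from `X`: it is optimal for the normalized
measures with densities `u` and `1 - u` with respect to `E`, where `u = ρ ^ w / (1 + ρ ^ w)`. -/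
theorem dTV_iid_sub_le_weight_test (Y X : PMF 𝒳) {E v : 𝒳 → ℝ} {w : 𝒳 → ℤ} {ρ η κ : ℝ}
    (hρ : 1 < ρ) (hη : 0 ≤ η) (hE : ∀ x, 0 ≤ E x) (hY : ∀ x, (Y x).toReal = v x * E x)
    (hX : ∀ x, (1 - v x) * E x ≤ (X x).toReal)
    (hκ : ∑ x, ((X x).toReal - (1 - v x) * E x) ≤ κ)
    (hw : ∀ x, |ρ ^ w x / (1 + ρ ^ w x) - v x| ≤ η) (k : ℕ) :
    dTV (iid Y k) (iid X k) - k * (16 * η + 2 * κ) ≤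
      ∑ x : Fin k → 𝒳, (if 0 ≤ ∑ i, w (x i) then 1 else 0)
        * (∏ i, (Y (x i)).toReal - ∏ i, (X (x i)).toReal) := by
  have hρ₀ : 0 < ρ := by linarith
  have hpos : 0 < 1 + 2 * η := by linarith
  set u : 𝒳 → ℝ := fun x => ρ ^ w x / (1 + ρ ^ w x) with hu
  have hu' : ∀ x, 1 - u x = 1 / (1 + ρ ^ w x) := by
    intro x
    have : 0 < ρ ^ w x := by positivity
    simp only [hu]
    field_simp
    ring
  have hu₀ : ∀ x, 0 ≤ u x := fun x => by positivity
  have hu₁ : ∀ x, 0 ≤ 1 - u x := fun x => by rw [hu']; positivity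
  have hs₀ : ∑ x, v x * E x = 1 := by
    rw [← sum_toReal_eq_one Y]; exact Finset.sum_congr rfl fun x _ => (hY x).symm
  have hs₁ : ∑ x, (1 - v x) * E x ≤ 1 :=
    (Finset.sum_le_sum fun x _ => hX x).trans (sum_toReal_eq_one X).le
  have hsE : ∑ x, E x ≤ 2 := by
    have : ∑ x, E x = ∑ x, v x * E x + ∑ x, (1 - v x) * E x := by
      rw [← Finset.sum_add_distrib]; exact Finset.sum_congr rfl fun x _ => by ring
    linarith
  set z₀ : 𝒳 → ℝ := fun x => u x * E x / (1 + 2 * η) with hz₀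
  set z₁ : 𝒳 → ℝ := fun x => (1 - u x) * E x / (1 + 2 * η) with hz₁
  have hz₀' : ∀ x, 0 ≤ z₀ x := fun x => div_nonneg (mul_nonneg (hu₀ x) (hE x)) hpos.le
  have hz₁' : ∀ x, 0 ≤ z₁ x := fun x => div_nonneg (mul_nonneg (hu₁ x) (hE x)) hpos.le
  obtain ⟨hz₀s, hz₀d⟩ := sum_div_perturbation (t := fun x => v x * E x) (t' := fun x => u x * E x)
    hη hs₀.le hsE (fun x => mul_nonneg (hu₀ x) (hE x)) fun x => by
      rw [← sub_mul, abs_mul, abs_of_nonneg (hE x)]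
      exact mul_le_mul_of_nonneg_right (hw x) (hE x)
  obtain ⟨hz₁s, hz₁d⟩ := sum_div_perturbation (t := fun x => (1 - v x) * E x)
    (t' := fun x => (1 - u x) * E x)
    hη hs₁ hsE (fun x => mul_nonneg (hu₁ x) (hE x)) fun x => by
      rw [← sub_mul, abs_mul, abs_of_nonneg (hE x), sub_sub_sub_cancel_left, abs_sub_comm]
      exact mul_le_mul_of_nonneg_right (hw x) (hE x)
  have hd₀ : ∑ x, |(Y x).toReal - z₀ x| ≤ 4 * η := by
    refine le_trans (le_of_eq ?_) hz₀d
    exact Finset.sum_congr rfl fun x _ => by rw [hY, abs_sub_comm]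
  have hd₁ : ∑ x, |(X x).toReal - z₁ x| ≤ 4 * η + κ := by
    calc ∑ x, |(X x).toReal - z₁ x|
        ≤ ∑ x, (((X x).toReal - (1 - v x) * E x) + |z₁ x - (1 - v x) * E x|) := by
          refine Finset.sum_le_sum fun x _ => (abs_sub_le _ ((1 - v x) * E x) _).trans ?_
          rw [abs_of_nonneg (sub_nonneg.2 (hX x)), abs_sub_comm (z₁ x)]
      _ ≤ _ := by rw [Finset.sum_add_distrib]; linarith
  have hD₀ := sum_abs_prod_sub_prod_le (fun _ => ENNReal.toReal_nonneg) (sum_toReal_eq_one Y).le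
    hz₀' hz₀s k
  have hD₁ := sum_abs_prod_sub_prod_le (fun _ => ENNReal.toReal_nonneg) (sum_toReal_eq_one X).le
    hz₁' hz₁s k
  -- The likelihood ratio of `z₀` and `z₁` is exactly `ρ ^ w`, so the sign of `∑ w` decides.
  have hopt : ∀ x : Fin k → 𝒳, max (∏ i, z₀ (x i) - ∏ i, z₁ (x i)) 0
      = (if 0 ≤ ∑ i, w (x i) then 1 else 0) * (∏ i, z₀ (x i) - ∏ i, z₁ (x i)) := by
    intro x
    have e : ∏ i, z₀ (x i) = ρ ^ (∑ i, w (x i)) * ∏ i, z₁ (x i) := by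
      have hprod : ρ ^ (∑ i, w (x i)) = ∏ i, ρ ^ w (x i) := by
        induction (Finset.univ : Finset (Fin k)) using Finset.cons_induction with
        | empty => simp
        | cons i S hi ih => rw [Finset.sum_cons, Finset.prod_cons, zpow_add₀ hρ₀.ne', ih]
      rw [hprod, ← Finset.prod_mul_distrib]
      refine Finset.prod_congr rfl fun i _ => ?_
      simp only [hz₀, hz₁, hu']
      simp only [hu]
      ring
    have hp : 0 ≤ ∏ i, z₁ (x i) := Finset.prod_nonneg fun i _ => hz₁' _
    have e' : ∏ i, z₀ (x i) - ∏ i, z₁ (x i)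
        = (ρ ^ (∑ i, w (x i)) - 1) * ∏ i, z₁ (x i) := by rw [e]; ring
    split_ifs with h
    · rw [one_mul, max_eq_left]
      rw [e']
      exact mul_nonneg (sub_nonneg.2 (one_le_zpow₀ hρ.le h)) hp
    · rw [zero_mul, max_eq_right]
      rw [e']
      exact mul_nonpos_of_nonpos_of_nonneg
        (sub_nonpos.2 (zpow_le_one_of_nonpos₀ hρ.le (not_le.1 h).le)) hp
  have hpt : ∀ x : Fin k → 𝒳,
      max (∏ i, (Y (x i)).toReal - ∏ i, (X (x i)).toReal) 0 ≤
        (if 0 ≤ ∑ i, w (x i) then 1 else 0)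
            * (∏ i, (Y (x i)).toReal - ∏ i, (X (x i)).toReal)
          + 2 * |∏ i, (Y (x i)).toReal - ∏ i, z₀ (x i)|
          + 2 * |∏ i, (X (x i)).toReal - ∏ i, z₁ (x i)| := by
    intro x
    have h := hopt x
    have h₀ := abs_le.1 (le_refl |∏ i, (Y (x i)).toReal - ∏ i, z₀ (x i)|)
    have h₁ := abs_le.1 (le_refl |∏ i, (X (x i)).toReal - ∏ i, z₁ (x i)|)
    have h₂ := le_max_left (∏ i, z₀ (x i) - ∏ i, z₁ (x i)) 0
    have h₃ := le_max_right (∏ i, z₀ (x i) - ∏ i, z₁ (x i)) 0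
    split_ifs at h ⊢
    · rw [one_mul] at h
      refine max_le ?_ ?_ <;> linarith [h₀.1, h₀.2, h₁.1, h₁.2]
    · rw [zero_mul] at h
      refine max_le ?_ ?_ <;> linarith [h₀.1, h₀.2, h₁.1, h₁.2]
  have hsum := Finset.sum_le_sum fun x (_ : x ∈ Finset.univ) => hpt x
  rw [Finset.sum_add_distrib, Finset.sum_add_distrib, ← Finset.mul_sum, ← Finset.mul_sum] at hsum
  rw [dTV_eq_sum_posPart]
  simp only [toReal_iid]
  have hk₀ : (k : ℝ) * ∑ x, |(Y x).toReal - z₀ x| ≤ k * (4 * η) := by gcongr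
  have hk₁ : (k : ℝ) * ∑ x, |(X x).toReal - z₁ x| ≤ k * (4 * η + κ) := by gcongr
  linarith

end Weights

/-! ### The simulated distribution -/

section Simulation

variable {𝒳 Q : Type*} [Fintype 𝒳] [DecidableEq Q]

theorem sum_cellSum [Fintype Q] (ℓ : 𝒳 → Q) (p : 𝒳 → ℝ) (f : 𝒳 → Bool) :
    ∑ a, cellSum ℓ p f a = ∑ x, (if f x then 1 else 0) * p x :=
  Finset.sum_fiberwise Finset.univ ℓ _

theorem cellSum_nonneg (ℓ : 𝒳 → Q) {p : 𝒳 → ℝ} (hp : ∀ x, 0 ≤ p x) (f : 𝒳 → Bool) (a : Q) :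
    0 ≤ cellSum ℓ p f a :=
  Finset.sum_nonneg fun x _ => mul_nonneg (by split_ifs <;> norm_num) (hp x)

theorem cellSum_le_cellSum_true (ℓ : 𝒳 → Q) {p : 𝒳 → ℝ} (hp : ∀ x, 0 ≤ p x) (f : 𝒳 → Bool)
    (a : Q) : cellSum ℓ p f a ≤ cellSum ℓ p (fun _ => true) a := by
  refine Finset.sum_le_sum fun x _ => ?_
  have := hp x
  cases f x <;> simp [this]

theorem cellSum_true (ℓ : 𝒳 → Q) (p : 𝒳 → ℝ) (a : Q) :
    cellSum ℓ p (fun _ => true) a = ∑ x with ℓ x = a, p x := by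
  simp [cellSum]

/-- In a cell where `q` is not negligible in comparison with `p`, replace `p` by the multiple of
`q` that has the same mass in the cell; leave `p` as it is in the other cells. -/
noncomputable def simulated (ℓ : 𝒳 → Q) (p q : 𝒳 → ℝ) (κ : ℝ) (x : 𝒳) : ℝ :=
  if κ * cellSum ℓ p (fun _ => true) (ℓ x) ≤ cellSum ℓ q (fun _ => true) (ℓ x) then
    cellSum ℓ p (fun _ => true) (ℓ x) / cellSum ℓ q (fun _ => true) (ℓ x) * q x
  else p x

theorem simulated_nonneg (ℓ : 𝒳 → Q) {p q : 𝒳 → ℝ} (hp : ∀ x, 0 ≤ p x) (hq : ∀ x, 0 ≤ q x)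
    (κ : ℝ) (x : 𝒳) : 0 ≤ simulated ℓ p q κ x := by
  unfold simulated
  split_ifs
  · exact mul_nonneg (div_nonneg (cellSum_nonneg ℓ hp _ _) (cellSum_nonneg ℓ hq _ _)) (hq x)
  · exact hp x

theorem cellSum_simulated (ℓ : 𝒳 → Q) (p q : 𝒳 → ℝ) (κ : ℝ) (f : 𝒳 → Bool) (a : Q) :
    cellSum ℓ (simulated ℓ p q κ) f a =
      if κ * cellSum ℓ p (fun _ => true) a ≤ cellSum ℓ q (fun _ => true) a then
        cellSum ℓ p (fun _ => true) a / cellSum ℓ q (fun _ => true) a * cellSum ℓ q f a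
      else cellSum ℓ p f a := by
  have e : ∀ x ∈ Finset.univ.filter (fun x => ℓ x = a), simulated ℓ p q κ x =
      if κ * cellSum ℓ p (fun _ => true) a ≤ cellSum ℓ q (fun _ => true) a then
        cellSum ℓ p (fun _ => true) a / cellSum ℓ q (fun _ => true) a * q x
      else p x := by
    intro x hx
    rw [simulated, (Finset.mem_filter.1 hx).2]
  conv_lhs => unfold cellSum
  rw [Finset.sum_congr rfl fun x hx => by rw [e x hx]]
  split_ifs
  · conv_rhs => enter [2]; unfold cellSum
    rw [Finset.mul_sum]
    exact Finset.sum_congr rfl fun x _ => by ring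
  · rfl

theorem cellSum_eq_zero_of_le {ℓ : 𝒳 → Q} {p q : 𝒳 → ℝ} (hp : ∀ x, 0 ≤ p x) {κ : ℝ}
    (hκ : 0 < κ) {a : Q}
    (h : κ * cellSum ℓ p (fun _ => true) a ≤ cellSum ℓ q (fun _ => true) a)
    (h₀ : cellSum ℓ q (fun _ => true) a = 0) : cellSum ℓ p (fun _ => true) a = 0 := by
  have h₁ := cellSum_nonneg ℓ hp (fun _ => true) a
  rw [h₀] at h
  nlinarith

theorem cellSum_simulated_true {ℓ : 𝒳 → Q} {p q : 𝒳 → ℝ} (hp : ∀ x, 0 ≤ p x) {κ : ℝ}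
    (hκ : 0 < κ) (a : Q) :
    cellSum ℓ (simulated ℓ p q κ) (fun _ => true) a = cellSum ℓ p (fun _ => true) a := by
  rw [cellSum_simulated]
  split_ifs with h
  · rcases eq_or_ne (cellSum ℓ q (fun _ => true) a) 0 with h₀ | h₀
    · rw [h₀, mul_zero, cellSum_eq_zero_of_le hp hκ h h₀]
    · exact div_mul_cancel₀ _ h₀
  · rfl

/-- Within a cell, the error of the simulation against `f` is controlled by the imbalances, with
respect to any prediction `v`, that `f` and the constant test detect in the cell. -/
theorem abs_cellSum_sub_cellSum_simulated_le {ℓ : 𝒳 → Q} {p q : 𝒳 → ℝ} (hp : ∀ x, 0 ≤ p x)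
    (hq : ∀ x, 0 ≤ q x) {κ : ℝ} (hκ : 0 < κ) (hκ₁ : κ ≤ 1) (f : 𝒳 → Bool) (a : Q) (v : ℝ) :
    |cellSum ℓ p f a - cellSum ℓ (simulated ℓ p q κ) f a| ≤
      2 / κ * (|(1 - v) * cellSum ℓ p f a - v * cellSum ℓ q f a|
        + |(1 - v) * cellSum ℓ p (fun _ => true) a - v * cellSum ℓ q (fun _ => true) a|) := by
  rw [cellSum_simulated]
  split_ifs with h
  swap
  · rw [sub_self, abs_zero]; positivity
  have hp₀ := cellSum_nonneg ℓ hp f a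
  have hq₀ := cellSum_nonneg ℓ hq f a
  have hp₁ := cellSum_le_cellSum_true ℓ hp f a
  have hq₁ := cellSum_le_cellSum_true ℓ hq f a
  have hz := cellSum_eq_zero_of_le hp hκ h
  generalize cellSum ℓ p f a = F₀ at *
  generalize cellSum ℓ q f a = F₁ at *
  generalize cellSum ℓ p (fun _ => true) a = P₀ at *
  generalize cellSum ℓ q (fun _ => true) a = P₁ at *
  rcases (hq₀.trans hq₁).eq_or_lt with h₀ | h₀
  · have h₁ : P₀ = 0 := hz h₀.symm
    have h₂ : F₀ = 0 := le_antisymm (h₁ ▸ hp₁) hp₀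
    rw [h₁, h₂]
    simp only [zero_div, zero_mul, sub_self, abs_zero]
    positivity
  have hP₀ := hp₀.trans hp₁
  have e : F₀ - P₀ / P₁ * F₁ = (P₀ + P₁) / P₁ * ((1 - v) * F₀ - v * F₁)
      - (F₀ + F₁) / P₁ * ((1 - v) * P₀ - v * P₁) := by
    field_simp; ring
  have hc : (P₀ + P₁) / P₁ ≤ 2 / κ := by
    rw [div_le_div_iff₀ h₀ hκ]
    nlinarith
  have hc' : (F₀ + F₁) / P₁ ≤ 2 / κ := le_trans (by gcongr) hc
  have hn : 0 ≤ (P₀ + P₁) / P₁ := by positivity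
  have hn' : 0 ≤ (F₀ + F₁) / P₁ := by positivity
  rw [e]
  refine (abs_sub _ _).trans ?_
  rw [abs_mul, abs_mul, abs_of_nonneg hn, abs_of_nonneg hn', mul_add]
  gcongr

end Simulation

/-- One distribution, simulated with the help of the other one, serves for all numbers of samples
`k`. The accuracy is given in the form `1 / R`. -/
theorem exists_simulation {𝒳 ι : Type*} [Fintype 𝒳] (enc : 𝒳 → ι → Bool) (X₀ X₁ : PMF 𝒳)
    (s : ℕ) {R : ℕ} (hR : 0 < R) :
    ∃ Y : PMF 𝒳, Indistinguishable enc s (1 / R) X₀ Y ∧ ∀ k : ℕ,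
      Distinguishable (encTuple enc k)
        ((k * (((16 * R ^ 2) ^ 2 + 1)
          * (s + 1 + 3 * ((16 * R ^ 2 + 1) * (2 * (k * (16 * R) ^ 2) + 1)))) : ℕ) : ℝ)
        (dTV (iid Y k) (iid X₁ k) - 2 * k * (1 / R)) (iid X₀ k) (iid X₁ k) := by
  have hR' : (0 : ℝ) < R := by exact_mod_cast hR
  have hR₁ : (1 : ℝ) ≤ R := by exact_mod_cast hR
  set p : 𝒳 → ℝ := fun x => (X₀ x).toReal with hp
  set q : 𝒳 → ℝ := fun x => (X₁ x).toReal with hq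
  have hp₀ : ∀ x, 0 ≤ p x := fun _ => ENNReal.toReal_nonneg
  have hq₀ : ∀ x, 0 ≤ q x := fun _ => ENNReal.toReal_nonneg
  have hp₁ : ∑ x, p x = 1 := sum_toReal_eq_one X₀
  have hq₁ : ∑ x, q x = 1 := sum_toReal_eq_one X₁
  have hM : 0 < 16 * R ^ 2 := by positivity
  set M : ℕ := 16 * R ^ 2 with hMdef
  obtain ⟨L, hL, hLs, hG⟩ := exists_steps_sum_abs_cellSum_le hp₀ hp₁ hq₀ hq₁ hM enc s
  set ℓ : 𝒳 → Fin (M + 1) := fun x => run L 0 (enc x) with hℓ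
  set κ : ℝ := 1 / (2 * R) with hκdef
  have hκ : 0 < κ := by positivity
  have hκ₁ : κ ≤ 1 := div_le_one_of_le₀ (by linarith) (by positivity)
  obtain ⟨Y, hY⟩ := exists_pmf_toReal_eq (simulated_nonneg ℓ hp₀ hq₀ κ) (by
    have h := sum_cellSum ℓ (simulated ℓ p q κ) fun _ => true
    simp only [cellSum_simulated_true hp₀ hκ, sum_cellSum, if_true, one_mul, hp₁] at h
    exact h.symm)
  refine ⟨Y, ?_, fun k => ?_⟩
  · intro f hf
    have hconst : ComputableBySize enc s fun _ : 𝒳 => true :=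
      ⟨constCircuit ι true, by simp, fun _ => rfl⟩
    have e : ∑ x, (if f x then 1 else 0) * ((X₀ x).toReal - (Y x).toReal)
        = ∑ a, (cellSum ℓ p f a - cellSum ℓ (simulated ℓ p q κ) f a) := by
      rw [Finset.sum_sub_distrib, sum_cellSum, sum_cellSum, ← Finset.sum_sub_distrib]
      exact Finset.sum_congr rfl fun x _ => by rw [hY]; ring
    rw [advantage, e]
    calc _ ≤ ∑ a, 2 / κ * (|(1 - levelValue a) * cellSum ℓ p f a - levelValue a * cellSum ℓ q f a|
            + |(1 - levelValue a) * cellSum ℓ p (fun _ => true) a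
              - levelValue a * cellSum ℓ q (fun _ => true) a|) :=
          (Finset.abs_sum_le_sum_abs _ _).trans (Finset.sum_le_sum fun a _ =>
            abs_cellSum_sub_cellSum_simulated_le hp₀ hq₀ hκ hκ₁ f a _)
      _ ≤ 2 / κ * (2 / M + 2 / M) := by
          rw [← Finset.mul_sum, Finset.sum_add_distrib]
          gcongr
          · exact hG f hf
          · exact hG _ hconst
      _ = 1 / R := by
          rw [hκdef, hMdef]; push_cast; field_simp; norm_num
  · set good : Fin (M + 1) → Prop := fun a =>
      κ * cellSum ℓ p (fun _ => true) a ≤ cellSum ℓ q (fun _ => true) a with hgood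
    classical
    set v : Fin (M + 1) → ℝ := fun a => if good a then
      cellSum ℓ p (fun _ => true) a
        / (cellSum ℓ p (fun _ => true) a + cellSum ℓ q (fun _ => true) a) else 1 with hv
    have hv₀ : ∀ a, 0 ≤ v a := by
      intro a
      have h₀ := cellSum_nonneg ℓ hp₀ (fun _ => true) a
      have h₁ := cellSum_nonneg ℓ hq₀ (fun _ => true) a
      simp only [hv]
      split_ifs <;> positivity
    have hv₁ : ∀ a, v a ≤ 1 := by
      intro a
      have h₀ := cellSum_nonneg ℓ hp₀ (fun _ => true) a
      have h₁ := cellSum_nonneg ℓ hq₀ (fun _ => true) a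
      simp only [hv]
      split_ifs
      · exact div_le_one_of_le₀ (by linarith) (by linarith)
      · exact le_rfl
    have hN : 0 < 16 * R := by positivity
    choose w hwW hw using fun a => exists_zpow_odds_close hN (hv₀ a) (hv₁ a)
    set E : 𝒳 → ℝ := fun x => (Y x).toReal + if good (ℓ x) then q x else 0 with hE
    have hYE : ∀ x, (Y x).toReal = v (ℓ x) * E x ∧
        (1 - v (ℓ x)) * E x = if good (ℓ x) then q x else 0 := by
      intro x
      have h₀ := cellSum_nonneg ℓ hp₀ (fun _ => true) (ℓ x)
      have h₁ := cellSum_nonneg ℓ hq₀ (fun _ => true) (ℓ x)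
      by_cases hg : good (ℓ x)
      · have hYx : (Y x).toReal = cellSum ℓ p (fun _ => true) (ℓ x)
            / cellSum ℓ q (fun _ => true) (ℓ x) * q x := by
          rw [hY, simulated, if_pos hg]
        simp only [hv, hE, if_pos hg, hYx]
        rcases h₁.eq_or_lt with h | h
        · rw [cellSum_eq_zero_of_le hp₀ hκ hg h.symm]
          simp
        · constructor
          · field_simp
          · field_simp
            ring
      · simp [hv, hE, if_neg hg]
    have key := dTV_iid_sub_le_weight_test Y X₁ (E := E) (v := fun x => v (ℓ x))
      (w := fun x => w (ℓ x)) (ρ := 1 + 1 / (16 * R : ℕ)) (η := 1 / (16 * R : ℕ)) (κ := κ)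
      (by
        have : (0 : ℝ) < 1 / (16 * R : ℕ) := by positivity
        linarith)
      (by positivity)
      (fun x => add_nonneg ENNReal.toReal_nonneg (by
        split_ifs
        · exact hq₀ x
        · exact le_rfl))
      (fun x => (hYE x).1)
      (fun x => by
        rw [(hYE x).2]
        split_ifs
        · exact le_rfl
        · exact hq₀ x)
      (by
        calc ∑ x, ((X₁ x).toReal - (1 - v (ℓ x)) * E x)
            = ∑ x, if good (ℓ x) then 0 else q x := by
              refine Finset.sum_congr rfl fun x _ => ?_
              rw [(hYE x).2]
              split_ifs
              · exact sub_self _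
              · exact sub_zero _
          _ = ∑ a, ∑ x with ℓ x = a, if good (ℓ x) then 0 else q x :=
              (Finset.sum_fiberwise Finset.univ ℓ _).symm
          _ ≤ ∑ a, κ * cellSum ℓ p (fun _ => true) a := by
              refine Finset.sum_le_sum fun a _ => ?_
              rw [Finset.sum_congr rfl fun x hx => by rw [(Finset.mem_filter.1 hx).2]]
              by_cases hg : good a
              · simp only [if_pos hg, Finset.sum_const_zero]
                exact mul_nonneg hκ.le (cellSum_nonneg ℓ hp₀ _ a)
              · simp only [if_neg hg]
                rw [← cellSum_true]
                exact (not_le.1 hg).le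
          _ = κ := by
              rw [← Finset.mul_sum, sum_cellSum]
              simp [hp₁])
      (fun x => hw (ℓ x)) k
    -- The test sees only the cells, to which `Y` and `X₀` give the same masses.
    have hswap := sum_mul_prod_eq_of_fiber_sum_eq (μ := fun x => (Y x).toReal) (ν := p) ℓ
      (fun a => by
        simp only [hY]
        rw [← cellSum_true, ← cellSum_true, cellSum_simulated_true hp₀ hκ])
      (k := k) fun a => if 0 ≤ ∑ i, w (a i) then 1 else 0
    refine ⟨fun x => decide (0 ≤ ∑ i, w (ℓ (x i))), ?_, ?_⟩
    · obtain ⟨C, hC, hCx⟩ := (jointlyComputable_weightSum (k := k) L hLs 0 w ((16 * R) ^ 2)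
        (k * (16 * R) ^ 2) hwW (List.finRange k)).exists_circuit ⟨0, by simp, rfl⟩
      refine ⟨C, ?_, fun x => ?_⟩
      · rw [List.length_finRange, Fintype.card_fin] at hC
        exact_mod_cast hC.trans (by gcongr)
      · rw [hCx, zero_add, ← Fin.sum_univ_def]
        rfl
    · refine le_trans ?_ (le_abs_self _)
      simp only [toReal_iid, decide_eq_true_eq]
      simp only [mul_sub, Finset.sum_sub_distrib] at key ⊢
      rw [hswap] at key
      refine le_trans (le_of_eq ?_) key
      rw [hκdef]
      push_cast
      field_simp
      ring

/-- The circuit size in `exists_simulation`, for an accuracy `1 / R` with `R` of the order of `t`: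
only the fourth power of `R` multiplies the size `s` of the tests. -/
theorem simulation_size_le {k s R : ℕ} {t : ℝ} (hk : 0 < k) (hR : 0 < R) (ht : 1 ≤ t)
    (hRt : (R : ℝ) ≤ 2 * t) {d : ℕ} (hd : 4 ≤ d) :
    ((k * (((16 * R ^ 2) ^ 2 + 1)
        * (s + 1 + 3 * ((16 * R ^ 2 + 1) * (2 * (k * (16 * R) ^ 2) + 1)))) : ℕ) : ℝ)
      ≤ 2 * 10 ^ 9 * (s * k * t ^ d) + 2 * 10 ^ 9 * (k * t) ^ 8 := by
  have hk₁ : (1 : ℝ) ≤ k := by exact_mod_cast hk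
  have h₁ : k * (((16 * R ^ 2) ^ 2 + 1)
      * (s + 1 + 3 * ((16 * R ^ 2 + 1) * (2 * (k * (16 * R) ^ 2) + 1))))
      ≤ 257 * (s * k * R ^ 4) + 6724148 * (k ^ 2 * R ^ 8) := by
    have hR₂ : 1 ≤ R ^ 2 := Nat.one_le_pow _ _ hR
    have hR₄ : 1 ≤ R ^ 4 := Nat.one_le_pow _ _ hR
    have hkR : 1 ≤ k * R ^ 2 := Nat.mul_pos hk (by positivity)
    have hkR₄ : 1 ≤ k * R ^ 4 := Nat.mul_pos hk (by positivity)
    calc _ ≤ k * ((256 * R ^ 4 + R ^ 4) * (s + k * R ^ 4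
            + 3 * ((16 * R ^ 2 + R ^ 2) * (512 * (k * R ^ 2) + k * R ^ 2)))) := by
          have e₁ : (16 * R ^ 2) ^ 2 = 256 * R ^ 4 := by ring
          have e₂ : 2 * (k * (16 * R) ^ 2) = 512 * (k * R ^ 2) := by ring
          rw [e₁, e₂]
          gcongr
      _ = 257 * (s * k * R ^ 4) + 6724148 * (k ^ 2 * R ^ 8) := by ring
  have h₂ : (R : ℝ) ^ 4 ≤ 16 * t ^ d := by
    calc (R : ℝ) ^ 4 ≤ (2 * t) ^ 4 := by gcongr
      _ = 16 * t ^ 4 := by ring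
      _ ≤ 16 * t ^ d := by gcongr
  have h₃ : (k : ℝ) ^ 2 * R ^ 8 ≤ 256 * (k * t) ^ 8 := by
    calc (k : ℝ) ^ 2 * R ^ 8 ≤ k ^ 8 * (2 * t) ^ 8 := by
          gcongr
          norm_num
      _ = 256 * (k * t) ^ 8 := by ring
  have h₄ : (s : ℝ) * k * R ^ 4 ≤ s * k * (16 * t ^ d) := by gcongr
  have h₅ : 0 ≤ (s : ℝ) * k * t ^ d := by positivity
  have h₆ : 0 ≤ (k * t : ℝ) ^ 8 := by positivity
  calc _ ≤ ((257 * (s * k * R ^ 4) + 6724148 * (k ^ 2 * R ^ 8) : ℕ) : ℝ) := by exact_mod_cast h₁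
    _ = 257 * (s * k * R ^ 4) + 6724148 * (k ^ 2 * R ^ 8) := by push_cast; ring
    _ ≤ _ := by linarith

/-- `exists_simulation` for a real accuracy, with any exponent that is at least the exponent `4`
which the construction gives. -/
theorem exists_simulation_of_exponent {d : ℕ} (hd : 4 ≤ d) {𝒳 ι : Type*} [Fintype 𝒳]
    (enc : 𝒳 → ι → Bool) (X₀ X₁ : PMF 𝒳) (s : ℕ) {ε : ℝ} (hε : 0 < ε) :
    ∃ Y : PMF 𝒳, ∀ k : ℕ, 0 < k →
      Indistinguishable enc s ε X₀ Y ∧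
      Indistinguishable (encTuple enc k) s (dTV (iid Y k) (iid X₁ k) + 2 * k * ε)
        (iid X₀ k) (iid X₁ k) ∧
      Distinguishable (encTuple enc k)
        (2 * 10 ^ 9 * (s * k / ε ^ d) + 2 * 10 ^ 9 * (k / ε) ^ 8)
        (dTV (iid Y k) (iid X₁ k) - 2 * k * ε) (iid X₀ k) (iid X₁ k) := by
  -- The upper bound on the advantage follows from the indistinguishability of a single sample.
  suffices H : ∃ Y : PMF 𝒳, Indistinguishable enc s ε X₀ Y ∧ ∀ k : ℕ, 0 < k →
      Distinguishable (encTuple enc k)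
        (2 * 10 ^ 9 * (s * k / ε ^ d) + 2 * 10 ^ 9 * (k / ε) ^ 8)
        (dTV (iid Y k) (iid X₁ k) - 2 * k * ε) (iid X₀ k) (iid X₁ k) by
    obtain ⟨Y, hY, hD⟩ := H
    refine ⟨Y, fun k hk => ⟨hY, fun f hf => ?_, hD k hk⟩⟩
    have h₁ := hY.iid hε.le k f hf
    have h₂ := advantage_le_dTV f (iid Y k) (iid X₁ k)
    have h₃ := advantage_triangle f (iid X₀ k) (iid Y k) (iid X₁ k)
    have h₄ : 0 ≤ (k : ℝ) * ε := by positivity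
    linarith
  rcases le_or_gt 1 ε with h | h
  · -- For `ε ≥ 1` the distinguishing claim is about a nonpositive advantage.
    refine ⟨X₀, indistinguishable_self enc s hε.le X₀, fun k hk => ⟨fun _ => true,
      ⟨constCircuit _ true, by simp only [constCircuit_size, Nat.cast_zero]; positivity,
        fun _ => rfl⟩, ?_⟩⟩
    have h₁ := dTV_le_one (iid X₀ k) (iid X₁ k)
    have h₂ : (1 : ℝ) ≤ k := by exact_mod_cast hk
    have h₃ := advantage_nonneg (fun _ => true) (iid X₀ k) (iid X₁ k)
    nlinarith
  · have ht : 1 ≤ 1 / ε := by rw [le_div_iff₀ hε]; linarith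
    have hR : 0 < ⌈1 / ε⌉₊ := Nat.ceil_pos.2 (by positivity)
    obtain ⟨Y, hY, hD⟩ := exists_simulation enc X₀ X₁ s hR
    have hRε : 1 / (⌈1 / ε⌉₊ : ℝ) ≤ ε := by
      rw [div_le_iff₀ (by exact_mod_cast hR), ← div_le_iff₀' hε]
      exact Nat.le_ceil _
    have hRt : (⌈1 / ε⌉₊ : ℝ) ≤ 2 * (1 / ε) := by
      have := Nat.ceil_lt_add_one (show 0 ≤ 1 / ε by positivity)
      linarith
    refine ⟨Y, fun f hf => (hY f hf).trans hRε, fun k hk => (hD k).mono ?_ ?_⟩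
    · refine (simulation_size_le hk hR ht hRt hd).trans_eq ?_
      rw [div_eq_mul_one_div ((s : ℝ) * k), ← one_div_pow, mul_one_div]
    · gcongr

end SampleDistinguishing

theorem theorem1p1 :
    ∃ (C : ℝ) (c : ℕ),
      ∀ (𝒳 : Type*) [Fintype 𝒳] (n : ℕ) (enc : 𝒳 ↪ (Fin n → Bool)) (X₀ X₁ : PMF 𝒳)
        (s : ℕ) (ε : ℝ), 0 < ε →
        (∃ Y₀ Y₁ : PMF 𝒳, ∀ k : ℕ, 0 < k →
          Indistinguishable enc s ε X₀ Y₀ ∧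
          Indistinguishable enc s ε X₁ Y₁ ∧
          Indistinguishable (encTuple enc k) s (dTV (iid Y₀ k) (iid Y₁ k) + 2 * k * ε)
            (iid X₀ k) (iid X₁ k) ∧
          Distinguishable (encTuple enc k) (C * (s * k / ε ^ 6) + C * (k / ε) ^ c)
            (dTV (iid Y₀ k) (iid Y₁ k) - 2 * k * ε) (iid X₀ k) (iid X₁ k)) ∧
        (∃ Y₀ : PMF 𝒳, ∀ k : ℕ, 0 < k →
          Indistinguishable enc s ε X₀ Y₀ ∧
          Indistinguishable (encTuple enc k) s (dTV (iid Y₀ k) (iid X₁ k) + 2 * k * ε)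
            (iid X₀ k) (iid X₁ k) ∧
          Distinguishable (encTuple enc k) (C * (s * k / ε ^ 12) + C * (k / ε) ^ c)
            (dTV (iid Y₀ k) (iid X₁ k) - 2 * k * ε) (iid X₀ k) (iid X₁ k)) := by
  refine ⟨2 * 10 ^ 9, 8, fun 𝒳 _ n enc X₀ X₁ s ε hε => ⟨?_, ?_⟩⟩
  · obtain ⟨Y, hY⟩ := exists_simulation_of_exponent (d := 6) (by norm_num) enc X₀ X₁ s hε
    exact ⟨Y, X₁, fun k hk => ⟨(hY k hk).1, indistinguishable_self _ _ hε.le X₁, (hY k hk).2⟩⟩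
  · exact exists_simulation_of_exponent (by norm_num) enc X₀ X₁ s hε
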